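/- Let $\mathcal H$ be a complex separable Hilbert space. For positive semidefinite self-adjoint trace-class operators $\rho,\rho_0$ on $\mathcal H$ with $\ker\rho_0\subseteq\ker\rho$, define the quantum relative entropy $$\mathrm{QKL}(\rho,\rho_0):=\operatorname{tr}\bigl(\rho_0-\rho+\rho\ln\rho-\rho\ln\rho_0\bigr)\in[0,\infty],$$ where $\ln$ is taken in the sense of the functional calculus, $\rho\ln\rho-\rho\ln\rho_0$ is defined to be zero on the kernels, and the trace is the sum of the (nonnegative) diagonal elements in an orthonormal basis of eigenvectors of $\rho_0$, being $+\infty$ if this sum diverges. For all other self-adjoint trace-class operators $\rho,\rho_0$ set $\mathrm{QKL}(\rho,\rho_0):=\infty$. Then, with Euler's number $\mathrm e$, for all self-adjoint trace-class operators $\rho,\rho_0$ on $\mathcal H$, $$\mathrm{QKL}(\rho,\rho_0)\ \ge\ \operatorname{tr}(\rho)+(1-\mathrm e)\operatorname{tr}(\rho_0).$$ -/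

import Mathlib

open scoped InnerProductSpace

noncomputable section

namespace QRE

universe u

variable {H : Type u} [NormedAddCommGroup H] [InnerProductSpace ℂ H] [CompleteSpace H]

/-! ### Trace-class operators and the trace -/

section TraceClass

variable (H) in
/-- The index set of a fixed (arbitrary) orthonormal basis of `H`. -/
def onbIndex : Set H := (exists_hilbertBasis ℂ H).choose

variable (H) in
/-- A fixed (arbitrary) orthonormal basis `f` of `H`. The notions defined with its help below do not
depend on which orthonormal basis is taken. -/
def onb : HilbertBasis (onbIndex H) ℂ H := (exists_hilbertBasis ℂ H).choose_spec.choose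

/-- Hilbert-Schmidt operators: compact operators with `∑ ‖T f_l‖ ^ 2 < ∞`. -/
def IsHilbertSchmidt (T : H →L[ℂ] H) : Prop :=
  IsCompactOperator T ∧ Summable fun l => ‖T (onb H l)‖ ^ 2

/-- Trace-class operators: Hilbert-Schmidt operators with `tr |T| = ∑ ⟨f_l, |T| f_l⟩ < ∞`,
where `|T| = √(T* T)`. -/
def IsTraceClass (T : H →L[ℂ] H) : Prop :=
  IsHilbertSchmidt T ∧ Summable fun l => ⟪onb H l, CFC.abs T (onb H l)⟫_ℂ

/-- The trace `tr T = ∑ ⟨f_l, T f_l⟩` of a trace-class operator. -/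
def trace (T : H →L[ℂ] H) : ℂ := ∑' l, ⟪onb H l, T (onb H l)⟫_ℂ

/-- Self-adjoint trace-class operators. -/
def IsSelfAdjointTraceClass (T : H →L[ℂ] H) : Prop :=
  IsSelfAdjoint T ∧ IsTraceClass T

/-- Positive semidefinite (self-adjoint) trace-class operators. -/
def IsPositiveTraceClass (T : H →L[ℂ] H) : Prop :=
  IsSelfAdjointTraceClass T ∧ T.IsPositive

end TraceClass

/-! ### Spectral decomposition and functional calculus of a compact self-adjoint operator -/

section Spectral

/-- An orthonormal basis `e_l` of eigenvectors of `T`, with real eigenvalues `T e_l = t_l e_l`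
(each eigenvalue, including `0`, occurs with its multiplicity). -/
structure EigenBasis (T : H →L[ℂ] H) where
  ι : Type u
  basis : HilbertBasis ι ℂ H
  val : ι → ℝ
  apply_basis : ∀ l, T (basis l) = (val l : ℂ) • basis l

/-- The spectral theorem: a compact self-adjoint operator has an orthonormal eigenbasis. -/
theorem exists_eigenBasis (T : H →L[ℂ] H) (hsa : IsSelfAdjoint T) (hc : IsCompactOperator T) :
    Nonempty (EigenBasis T) := by
  have hsym : (T : H →ₗ[ℂ] H).IsSymmetric :=
    ContinuousLinearMap.isSelfAdjoint_iff_isSymmetric.mp hsa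
  let E : ℂ → Submodule ℂ H := fun μ => Module.End.eigenspace (T : H →ₗ[ℂ] H) μ
  have hEclosed : ∀ μ, IsClosed (E μ : Set H) := by
    intro μ
    have : (E μ : Set H) = {x | T x = μ • x} := by
      ext x; simp [E]
    rw [this]
    exact isClosed_eq T.continuous (continuous_const_smul μ)
  have hEc : ∀ μ, CompleteSpace (E μ) := fun μ => (hEclosed μ).completeSpace_coe
  have hfam : OrthogonalFamily ℂ (fun μ => E μ) fun μ => (E μ).subtypeₗᵢ :=
    hsym.orthogonalFamily_eigenspaces
  choose w b hb using fun μ => exists_hilbertBasis ℂ (E μ)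
  let v : (Σ μ : ℂ, w μ) → H := fun a => ((b a.1 a.2 : E a.1) : H)
  have hv : Orthonormal ℂ v := hfam.orthonormal_sigma_orthonormal fun μ => (b μ).orthonormal
  have hperp : (Submodule.span ℂ (Set.range v))ᗮ = ⊥ := by
    rw [eq_bot_iff]
    intro x hx
    have hbot := ContinuousLinearMap.orthogonalComplement_iSup_eigenspaces_eq_bot hc hsym
    rw [← hbot, Submodule.mem_orthogonal]
    have hle : (⨆ μ, E μ) ≤ (Submodule.span ℂ {x})ᗮ := by
      refine iSup_le fun μ => ?_
      intro y hy
      rw [Submodule.mem_orthogonal_singleton_iff_inner_right]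
      have hs := (b μ).hasSum_repr ⟨y, hy⟩
      have hs2 := hs.mapL ((innerSL ℂ x).comp (E μ).subtypeL)
      have hz : ∀ i, ((innerSL ℂ x).comp (E μ).subtypeL)
          ((b μ).repr ⟨y, hy⟩ i • (b μ) i) = 0 := by
        intro i
        have : ⟪v ⟨μ, i⟩, x⟫_ℂ = 0 :=
          (Submodule.mem_orthogonal _ _).1 hx _ (Submodule.subset_span ⟨_, rfl⟩)
        have h2 : ⟪x, ((b μ i : E μ) : H)⟫_ℂ = 0 := inner_eq_zero_symm.1 this
        simp [h2]
      simp only [hz] at hs2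
      simpa using hs2.unique hasSum_zero
    intro u hu
    have := hle hu
    rw [Submodule.mem_orthogonal_singleton_iff_inner_right] at this
    exact inner_eq_zero_symm.1 this
  have happ : ∀ a, T (v a) = a.1 • v a := fun a => by
    exact Module.End.mem_eigenspace_iff.1 (b a.1 a.2).2
  refine ⟨⟨_, HilbertBasis.mkOfOrthogonalEqBot hv hperp, fun a => a.1.re, fun a => ?_⟩⟩
  rw [HilbertBasis.coe_mkOfOrthogonalEqBot, happ a]
  have hev : Module.End.HasEigenvalue (T : H →ₗ[ℂ] H) a.1 :=
    Module.End.hasEigenvalue_of_hasEigenvector (x := v a)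
      ⟨by simpa using happ a, hv.ne_zero a⟩
  have hre := Complex.conj_eq_iff_re.1 (hsym.conj_eigenvalue_eq_self hev)
  rw [hre]

/-- A choice of an orthonormal eigenbasis of a self-adjoint trace-class operator. -/
def eigenBasis (T : H →L[ℂ] H) (hT : IsSelfAdjointTraceClass T) : EigenBasis T :=
  (exists_eigenBasis T hT.1 hT.2.1.1).some

/-- The functional calculus `φ(T) f = ∑ φ(t_l) ⟨e_l, f⟩ e_l`, for all vectors `f` for which
the series converges (`φ(T)` may be an unbounded operator). -/
def EigenBasis.apply {T : H →L[ℂ] H} (e : EigenBasis T) (φ : ℝ → ℝ) (f : H) : H :=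
  ∑' l, ((φ (e.val l) : ℂ) * ⟪e.basis l, f⟫_ℂ) • e.basis l

/-- The eigenvectors of `T` belong to the domain of each `φ(T)`, where `φ(T) e_j = φ(t_j) e_j`. -/
theorem EigenBasis.hasSum_basis {T : H →L[ℂ] H} (e : EigenBasis T) (φ : ℝ → ℝ) (j : e.ι) :
    HasSum (fun l => ((φ (e.val l) : ℂ) * ⟪e.basis l, e.basis j⟫_ℂ) • e.basis l)
      ((φ (e.val j) : ℂ) • e.basis j) := by
  classical
  have h := hasSum_single (f := fun l =>
    ((φ (e.val l) : ℂ) * ⟪e.basis l, e.basis j⟫_ℂ) • e.basis l) j (fun l hl => by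
      simp [orthonormal_iff_ite.1 e.basis.orthonormal l j, hl])
  rwa [orthonormal_iff_ite.1 e.basis.orthonormal j j, if_pos rfl, mul_one] at h

end Spectral

/-! ### The quantum relative entropy -/

section Entropy

/-- The diagonal elements `⟨f_j, (ρ₀ - ρ + ρ ln ρ - ρ ln ρ₀) f_j⟩`, where `f_j` is an orthonormal
basis of eigenvectors of `ρ₀`. Each `f_j` lies in the domains of `ln ρ₀` and of the bounded operator
`ρ ln ρ = η(ρ)`, where `η(t) = t ln t`, `η(0) = 0`. If `ρ₀ f_j = 0` then `ρ f_j = 0` whenever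
`ker ρ₀ ⊆ ker ρ`, and the element is zero, as `ρ ln ρ - ρ ln ρ₀` is zero on the kernels.
These numbers are real. -/
def entropyDiag {ρ ρ₀ : H →L[ℂ] H} (e : EigenBasis ρ) (f : EigenBasis ρ₀) (j : f.ι) : ℝ :=
  (⟪f.basis j,
    ρ₀ (f.basis j) - ρ (f.basis j) + e.apply (fun t => t * Real.log t) (f.basis j)
      - ρ (f.apply Real.log (f.basis j))⟫_ℂ).re

open Classical in
/-- The quantum relative entropy: `tr (ρ₀ - ρ + ρ ln ρ - ρ ln ρ₀)` if `ρ` and `ρ₀` are positive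
semidefinite trace-class operators with `ker ρ₀ ⊆ ker ρ`, and `∞` otherwise.
The diagonal elements in an eigenbasis of `ρ₀` are nonnegative in the first case
(Klein's inequality), so the trace is a number in `[0, ∞]`: the sum of the diagonal elements if
that converges, and `∞` if it diverges. -/
def QKL (ρ ρ₀ : H →L[ℂ] H) : EReal :=
  if h : IsPositiveTraceClass ρ ∧ IsPositiveTraceClass ρ₀ ∧
      LinearMap.ker (ρ₀ : H →ₗ[ℂ] H) ≤ LinearMap.ker (ρ : H →ₗ[ℂ] H) then
    if Summable (entropyDiag (eigenBasis ρ h.1.1) (eigenBasis ρ₀ h.2.1.1)) then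
      ((∑' j, entropyDiag (eigenBasis ρ h.1.1) (eigenBasis ρ₀ h.2.1.1) j : ℝ) : EReal)
    else ⊤
  else ⊤

end Entropy

end QRE

end

/-!
Let `e_i` be an eigenbasis of `ρ` with eigenvalues `t_i ≥ 0`, and `f_j` an eigenbasis of `ρ₀` with
eigenvalues `s_j ≥ 0`. The weights `p_ij = |⟨e_i, f_j⟩|²` satisfy `∑_i p_ij = ∑_j p_ij = 1`, and
`⟨f_j, φ(ρ) f_j⟩ = ∑_i φ(t_i) p_ij`. The tangent line at `t = e s` to the convex function
`t ↦ t ln t` gives `t ln t ≥ t ln s + 2 t - e s`. Averaging this with the weights `p_ij` shows that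
each diagonal element of the entropy is at least `⟨f_j, ρ f_j⟩ + (1 - e) s_j`
(`QRE.le_entropyDiag`). Where `s_j = 0`, the inclusion of the kernels makes both sides vanish.

It remains to sum over `j`. The trace is defined by another basis, but by Tonelli's theorem the
diagonal of a positive operator has the same sum, namely that of the eigenvalues, in all orthonormal
bases (`QRE.EigenBasis.tsum_ofReal_re_inner`, `QRE.IsPositiveTraceClass.hasSum_trace`).
-/

open scoped InnerProductSpace

namespace QRE

variable {H : Type*} [NormedAddCommGroup H] [InnerProductSpace ℂ H]

/-- The tangent line at `t = e * s` to the convex function `t ↦ t * log t` lies below it. -/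
theorem mul_log_tangent_le {s t : ℝ} (hs : 0 < s) (ht : 0 ≤ t) :
    t * Real.log s + 2 * t - Real.exp 1 * s ≤ t * Real.log t := by
  rcases ht.eq_or_lt with rfl | ht
  · have := mul_pos (Real.exp_pos 1) hs
    simp only [zero_mul, mul_zero]
    linarith
  · have h := Real.log_le_sub_one_of_pos (div_pos (mul_pos (Real.exp_pos 1) hs) ht)
    rw [Real.log_div (mul_pos (Real.exp_pos 1) hs).ne' ht.ne',
      Real.log_mul (Real.exp_pos 1).ne' hs.ne', Real.log_exp] at h
    have h2 := mul_le_mul_of_nonneg_left h ht.le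
    have h3 : t * (Real.exp 1 * s / t - 1) = Real.exp 1 * s - t := by field_simp
    linarith

theorem hasSum_sq_norm_inner {ι : Type*} (b : HilbertBasis ι ℂ H) (x : H) :
    HasSum (fun i => ‖⟪b i, x⟫_ℂ‖ ^ 2) (‖x‖ ^ 2) := by
  have h := Complex.hasSum_re (b.hasSum_inner_mul_inner x x)
  convert h using 1
  · funext i
    rw [← inner_conj_symm x (b i), ← Complex.normSq_eq_conj_mul_self, Complex.ofReal_re,
      Complex.normSq_eq_norm_sq]
  · exact norm_sq_eq_re_inner (𝕜 := ℂ) x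

namespace EigenBasis

variable {T : H →L[ℂ] H} (e : EigenBasis T)

theorem inner_apply_basis (i : e.ι) : ⟪e.basis i, T (e.basis i)⟫_ℂ = e.val i := by
  rw [e.apply_basis, inner_smul_right, inner_self_eq_norm_sq_to_K, e.basis.orthonormal.1 i]
  simp

theorem val_nonneg (hT : T.IsPositive) (i : e.ι) : 0 ≤ e.val i := by
  have h := hT.inner_nonneg_right (e.basis i)
  rw [e.inner_apply_basis] at h
  exact_mod_cast h

theorem abs_val_le (i : e.ι) : |e.val i| ≤ ‖T‖ := by
  have h := T.le_opNorm (e.basis i)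
  rwa [e.apply_basis, norm_smul, e.basis.orthonormal.1 i, mul_one, mul_one, Complex.norm_real,
    Real.norm_eq_abs] at h

/-- If `φ` is bounded on the eigenvalues, the series `φ(T) x` converges. -/
theorem hasSum_apply {φ : ℝ → ℝ} {C : ℝ} (hφ : ∀ i, |φ (e.val i)| ≤ C) (x : H) :
    HasSum (fun i => ((φ (e.val i) : ℂ) * ⟪e.basis i, x⟫_ℂ) • e.basis i) (e.apply φ x) := by
  have hmem : Memℓp (fun i => (φ (e.val i) : ℂ) * ⟪e.basis i, x⟫_ℂ) 2 := by
    refine memℓp_gen (Summable.of_nonneg_of_le (fun i => by positivity) (fun i => ?_)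
      ((hasSum_sq_norm_inner e.basis x).summable.mul_left (C ^ 2)))
    have h : ‖(φ (e.val i) : ℂ) * ⟪e.basis i, x⟫_ℂ‖ ≤ C * ‖⟪e.basis i, x⟫_ℂ‖ := by
      rw [norm_mul, Complex.norm_real, Real.norm_eq_abs]
      exact mul_le_mul_of_nonneg_right (hφ i) (norm_nonneg _)
    rw [← mul_pow]
    simpa using pow_le_pow_left₀ (norm_nonneg _) h 2
  exact (e.basis.hasSum_repr_symm ⟨_, hmem⟩).summable.hasSum

/-- `⟨x, φ(T) x⟩ = ∑ φ(t_i) |⟨e_i, x⟩|²`. -/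
theorem hasSum_re_inner_apply {φ : ℝ → ℝ} {C : ℝ} (hφ : ∀ i, |φ (e.val i)| ≤ C) (x : H) :
    HasSum (fun i => φ (e.val i) * ‖⟪e.basis i, x⟫_ℂ‖ ^ 2) (⟪x, e.apply φ x⟫_ℂ).re := by
  have h := Complex.hasSum_re ((e.hasSum_apply hφ x).mapL (innerSL ℂ x))
  simp only [innerSL_apply_apply] at h
  convert h using 1
  funext i
  rw [inner_smul_right, mul_assoc, ← inner_conj_symm x (e.basis i),
    Complex.mul_conj, Complex.normSq_eq_norm_sq, ← Complex.ofReal_mul, Complex.ofReal_re]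

theorem apply_id (x : H) : e.apply id x = T x := by
  refine HasSum.tsum_eq ?_
  convert (e.basis.hasSum_repr x).mapL T using 1
  funext i
  rw [map_smul, e.apply_basis, smul_smul, HilbertBasis.repr_apply_apply, mul_comm]
  rfl

/-- `⟨x, T x⟩ = ∑ t_i |⟨e_i, x⟩|²`. -/
theorem hasSum_re_inner (x : H) :
    HasSum (fun i => e.val i * ‖⟪e.basis i, x⟫_ℂ‖ ^ 2) (⟪x, T x⟫_ℂ).re := by
  simpa only [e.apply_id, id] using e.hasSum_re_inner_apply (φ := id) e.abs_val_le x

/-- In `[0, ∞]`, the diagonal elements of a positive operator in any orthonormal basis add up to the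
sum of the eigenvalues. -/
theorem tsum_ofReal_re_inner (hT : T.IsPositive) {κ : Type*} (b : HilbertBasis κ ℂ H) :
    ∑' j, ENNReal.ofReal (⟪b j, T (b j)⟫_ℂ).re = ∑' i, ENNReal.ofReal (e.val i) := by
  have hrow : ∀ j, ENNReal.ofReal (⟪b j, T (b j)⟫_ℂ).re =
      ∑' i, ENNReal.ofReal (e.val i) * ENNReal.ofReal (‖⟪b j, e.basis i⟫_ℂ‖ ^ 2) := fun j => by
    have h := e.hasSum_re_inner (b j)
    rw [← h.tsum_eq, ENNReal.ofReal_tsum_of_nonneg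
      (fun i => mul_nonneg (e.val_nonneg hT i) (by positivity)) h.summable]
    refine tsum_congr fun i => ?_
    rw [ENNReal.ofReal_mul (e.val_nonneg hT i), norm_inner_symm]
  have hcol : ∀ i, ∑' j, ENNReal.ofReal (‖⟪b j, e.basis i⟫_ℂ‖ ^ 2) = 1 := fun i => by
    have h := hasSum_sq_norm_inner b (e.basis i)
    rw [← ENNReal.ofReal_tsum_of_nonneg (fun j => by positivity) h.summable, h.tsum_eq,
      e.basis.orthonormal.1 i]
    simp
  simp_rw [hrow]
  rw [ENNReal.tsum_comm]
  simp_rw [ENNReal.tsum_mul_left, hcol, mul_one]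

end EigenBasis

variable [CompleteSpace H]

/-- The trace of a positive trace-class operator is the sum of its diagonal in any orthonormal
basis. -/
theorem IsPositiveTraceClass.hasSum_trace {T : H →L[ℂ] H} (hT : IsPositiveTraceClass T)
    {κ : Type*} (b : HilbertBasis κ ℂ H) :
    HasSum (fun j => (⟪b j, T (b j)⟫_ℂ).re) (trace T).re := by
  have habs : CFC.abs T = T :=
    CFC.abs_of_nonneg T ((ContinuousLinearMap.nonneg_iff_isPositive T).2 hT.2)
  have hsum : Summable fun l => ⟪onb H l, T (onb H l)⟫_ℂ := by
    simpa only [habs] using hT.1.2.2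
  have hre := Complex.hasSum_re hsum.hasSum
  have hnn : ∀ x : H, 0 ≤ (⟪x, T x⟫_ℂ).re := fun x => hT.2.re_inner_nonneg_right x
  have heq : ∑' j, ENNReal.ofReal (⟪b j, T (b j)⟫_ℂ).re = ENNReal.ofReal (trace T).re := by
    rw [(eigenBasis T hT.1).tsum_ofReal_re_inner hT.2 b,
      ← (eigenBasis T hT.1).tsum_ofReal_re_inner hT.2 (onb H),
      ← ENNReal.ofReal_tsum_of_nonneg (fun l => hnn _) hre.summable, hre.tsum_eq]
    rfl
  have htr : 0 ≤ (trace T).re := hre.nonneg fun l => hnn _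
  have h := ENNReal.hasSum_toReal (heq ▸ ENNReal.ofReal_ne_top)
  rw [← ENNReal.tsum_toReal_eq (fun _ => ENNReal.ofReal_ne_top), heq,
    ENNReal.toReal_ofReal htr] at h
  simpa only [ENNReal.toReal_ofReal (hnn _)] using h

/-- The inequality between the traces holds for each diagonal element in an eigenbasis of `ρ₀`. -/
theorem le_entropyDiag {ρ ρ₀ : H →L[ℂ] H} (hρ : ρ.IsPositive) (hρ₀ : ρ₀.IsPositive)
    (hker : LinearMap.ker (ρ₀ : H →ₗ[ℂ] H) ≤ LinearMap.ker (ρ : H →ₗ[ℂ] H))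
    (e : EigenBasis ρ) (f : EigenBasis ρ₀) (j : f.ι) :
    (⟪f.basis j, ρ (f.basis j)⟫_ℂ).re +
      (1 - Real.exp 1) * (⟪f.basis j, ρ₀ (f.basis j)⟫_ℂ).re ≤ entropyDiag e f j := by
  obtain ⟨C, hC⟩ := isCompact_Icc.exists_bound_of_continuousOn (s := Set.Icc (-‖ρ‖) ‖ρ‖)
    Real.continuous_mul_log.continuousOn
  have hent := e.hasSum_re_inner_apply (φ := fun t => t * Real.log t)
    (fun i => hC _ (abs_le.1 (e.abs_val_le i))) (f.basis j)
  have hdiag := e.hasSum_re_inner (f.basis j)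
  have hone : HasSum (fun i => ‖⟪e.basis i, f.basis j⟫_ℂ‖ ^ 2) 1 := by
    simpa [f.basis.orthonormal.1 j] using hasSum_sq_norm_inner e.basis (f.basis j)
  have hlog : f.apply Real.log (f.basis j) = (Real.log (f.val j) : ℂ) • f.basis j :=
    (f.hasSum_basis Real.log j).tsum_eq
  rw [entropyDiag, hlog, map_smul, inner_sub_right, inner_add_right, inner_sub_right,
    inner_smul_right, Complex.sub_re, Complex.add_re, Complex.sub_re, Complex.re_ofReal_mul,
    f.inner_apply_basis, Complex.ofReal_re]
  rcases (f.val_nonneg hρ₀ j).eq_or_lt with hs | hs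
  · -- On the kernel of `ρ₀` the operator `ρ` vanishes, so only eigenvalues `t_i = 0` have weight.
    have hzero : ρ (f.basis j) = 0 := hker (by
      change ρ₀ (f.basis j) = 0
      rw [f.apply_basis, ← hs, Complex.ofReal_zero, zero_smul])
    rw [hzero, inner_zero_right, Complex.zero_re] at hdiag
    have hterm := (hasSum_zero_iff_of_nonneg
      (fun i => mul_nonneg (e.val_nonneg hρ i) (by positivity))).1 hdiag
    have hent0 : (⟪f.basis j, e.apply (fun t => t * Real.log t) (f.basis j)⟫_ℂ).re = 0 := by
      refine hent.unique (hasSum_zero.congr_fun fun i => ?_)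
      have := congrFun hterm i
      simp only [Pi.zero_apply] at this
      rw [mul_right_comm, this, zero_mul]
    simp [hzero, hent0, ← hs]
  · have hlin := ((hdiag.mul_right (Real.log (f.val j))).add (hdiag.mul_left 2)).sub
      (hone.mul_left (Real.exp 1 * f.val j))
    have hle := hasSum_le (fun i => ?_) hlin hent
    · linarith
    · have := mul_le_mul_of_nonneg_right (mul_log_tangent_le hs (e.val_nonneg hρ i))
        (sq_nonneg ‖⟪e.basis i, f.basis j⟫_ℂ‖)
      linarith

end QRE

theorem lemma2p5 {H : Type*} [NormedAddCommGroup H] [InnerProductSpace ℂ H] [CompleteSpace H]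
    [TopologicalSpace.SeparableSpace H] (ρ ρ₀ : H →L[ℂ] H)
    (hρ : QRE.IsSelfAdjointTraceClass ρ) (hρ₀ : QRE.IsSelfAdjointTraceClass ρ₀) :
    (((QRE.trace ρ).re + (1 - Real.exp 1) * (QRE.trace ρ₀).re : ℝ) : EReal) ≤ QRE.QKL ρ ρ₀ := by
  unfold QRE.QKL
  split_ifs with h hsum
  · let f := QRE.eigenBasis ρ₀ h.2.1.1
    refine EReal.coe_le_coe_iff.2 (hasSum_le (fun j => ?_)
      ((h.1.hasSum_trace f.basis).add ((h.2.1.hasSum_trace f.basis).mul_left (1 - Real.exp 1)))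
      hsum.hasSum)
    exact QRE.le_entropyDiag h.1.2 h.2.1.2 h.2.2 _ f j
  · exact le_top
  · exact le_top
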